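/- Let $(\Omega,\mathcal F,P)$ be a standard Borel probability space, and let the target $Y$, the terminal information state $M$ and the verifier signal $W$ be random variables on it with values in standard Borel spaces. A bounded loss is a jointly measurable function $\ell:\mathcal A\times\mathcal Y\to[0,C]$, with $\mathcal A$ standard Borel, $\mathcal Y$ the value space of $Y$, and $C<\infty$. For an information state (random variable) $H$ put $V(H;\ell)=\inf_{\delta}\mathbb E[\ell(\delta,Y)]$, the infimum being over all maps $\delta:\Omega\to\mathcal A$ that are measurable with respect to the universal completion of $\sigma(H)$. A state $S$ is Blackwell-dominated by $T$ as an experiment about $Y$ if there is a Markov kernel $\kappa$ from the value space of $T$ to that of $S$ such that $P(S\in\cdot\mid Y=y)=\int\kappa(t,\cdot)\,P(T\in dt\mid Y=y)$ for $P_Y$-almost every $y$. Then: 1. $V((M,W);\ell)\le V(M;\ell)$ for every bounded loss $\ell$. 2. If $(M,W)$ is not Blackwell-dominated by $M$ as an experiment about $Y$, then there are a finite action set and a bounded loss $\ell$ on it with $V((M,W);\ell)<V(M;\ell)$. 3. $(M,W)$ is not Blackwell-dominated by $M$ as an experiment about $Y$ if and only if $W$ is not redundant given $M$ for predicting $Y$,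 where redundant means that $P(Y\in B\mid M,W)=P(Y\in B\mid M)$ almost surely for every measurable $B$. 4. Self-critique that only re-reads $M$ cannot move the Bayes value: if $W=c(M,\xi)$ almost surely, with $c$ measurable and $\xi$ a standard Borel valued random variable that is conditionally independent of $Y$ given $M$, then $V((M,W);\ell)=V(M;\ell)$ for every bounded loss $\ell$. 5. An external signal can move it: there are a law of $(Y,M,W)$ on $\{0,1\}^3$ and a bounded loss $\ell$ on a two-point action set with $V((M,W);\ell)<V(M;\ell)$. -/

import Mathlib

open MeasureTheory ProbabilityTheory
open scoped ENNReal NNReal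

namespace DecisionModel

/-- The universal completion of a σ-algebra `m`: the sets that are measurable with respect to the
completion of every finite measure defined on `m`. -/
abbrev universalCompletion {Ω : Type*} (m : MeasurableSpace Ω) : MeasurableSpace Ω where
  MeasurableSet' s := ∀ ν : @Measure Ω m, @IsFiniteMeasure Ω m ν → @NullMeasurableSet Ω m s ν
  measurableSet_empty ν _ := @nullMeasurableSet_empty Ω m ν
  measurableSet_compl _ hs ν hν := @NullMeasurableSet.compl Ω m ν _ (hs ν hν)
  measurableSet_iUnion _ hs ν hν :=
    @NullMeasurableSet.iUnion Ω m ν ℕ _ _ (fun i => hs i ν hν)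

/-- A decision rule based on the information state `H`: a map into the action space which is
measurable with respect to the universal completion of `σ(H)`. -/
def IsDecisionRule {Ω 𝓗 A : Type*} [MeasurableSpace 𝓗] [MeasurableSpace A]
    (H : Ω → 𝓗) (δ : Ω → A) : Prop :=
  @Measurable Ω A (universalCompletion (MeasurableSpace.comap H inferInstance)) _ δ

/-- The Bayes risk `V(H; ℓ) = inf_δ E[ℓ(δ, Y)]`, the infimum being over all decision rules based
on `H`. -/
noncomputable def bayesRisk {Ω 𝓨 𝓗 A : Type*} [MeasurableSpace Ω] [MeasurableSpace 𝓗]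
    [MeasurableSpace A] (P : Measure Ω) (Y : Ω → 𝓨) (H : Ω → 𝓗) (ℓ : A → 𝓨 → ℝ≥0∞) : ℝ≥0∞ :=
  ⨅ (δ : Ω → A) (_ : IsDecisionRule H δ), ∫⁻ ω, ℓ (δ ω) (Y ω) ∂P

/-- A bounded (jointly measurable, nonnegative) loss. -/
structure IsBoundedLoss {A 𝓨 : Type*} [MeasurableSpace A] [MeasurableSpace 𝓨]
    (ℓ : A → 𝓨 → ℝ≥0∞) : Prop where
  measurable : Measurable (Function.uncurry ℓ)
  bounded : ∃ C : ℝ≥0, ∀ a y, ℓ a y ≤ C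

/-- `S` is Blackwell-dominated by `T` as an experiment about `Y`: the conditional law of `S`
given `Y = y` is obtained from the conditional law of `T` given `Y = y` by one Markov kernel `κ`
that does not depend on `y` (for almost every `y` under the law of `Y`). -/
def BlackwellDominated {Ω 𝓨 𝓢 𝓣 : Type*} [MeasurableSpace Ω] [MeasurableSpace 𝓨]
    [MeasurableSpace 𝓢] [StandardBorelSpace 𝓢] [Nonempty 𝓢]
    [MeasurableSpace 𝓣] [StandardBorelSpace 𝓣] [Nonempty 𝓣]
    (P : Measure Ω) [IsFiniteMeasure P] (Y : Ω → 𝓨) (S : Ω → 𝓢) (T : Ω → 𝓣) : Prop :=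
  ∃ κ : Kernel 𝓣 𝓢, IsMarkovKernel κ ∧
    ∀ᵐ y ∂(P.map Y), condDistrib S Y P y = (κ ∘ₖ condDistrib T Y P) y

/-- `W` is redundant given `M` for predicting `Y`: adding `W` to `M` does not change the
conditional probability of any event about `Y`. -/
def IsRedundant {Ω 𝓨 𝓜 𝓦 : Type*} [MeasurableSpace Ω] [MeasurableSpace 𝓨]
    [MeasurableSpace 𝓜] [MeasurableSpace 𝓦]
    (P : Measure Ω) (Y : Ω → 𝓨) (M : Ω → 𝓜) (W : Ω → 𝓦) : Prop :=
  ∀ B : Set 𝓨, MeasurableSet B →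
    P⟦Y ⁻¹' B | MeasurableSpace.comap (fun ω => (M ω, W ω)) inferInstance⟧
      =ᵐ[P] P⟦Y ⁻¹' B | MeasurableSpace.comap M inferInstance⟧

end DecisionModel

/-! Write `f = P(Y ∈ B | M, W)` and `g = P(Y ∈ B | M)`. If `W` is not redundant, these differ for
some `B`, yet they have equal integrals over every event of `σ(M)`. Hence `f < t < g` with positive
probability for some `t`, and `E min(t, f) < E min(t, g)`: the bet on `B` at price `t` is strictly
better with `W`. No rule based on `M`, even a randomised one, gets below `E min(t, g)`. This gives
the strict gain in Bayes risk and also excludes Blackwell domination, since a kernel would turn the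
better rule into a randomised rule based on `M`. Conversely, redundancy is conditional independence
of `W` and `Y` given `M`, so drawing `W` from its conditional law given `M` is a garbling. For
self-critique, the ancillary noise is simulated by a uniform variable, and some fixed value of it
does at least as well as the average. -/

namespace DecisionModel

/-! ### Decision rules and Bayes risk -/

section Rules

variable {Ω 𝓨 𝓗 A : Type*} [MeasurableSpace 𝓗] [MeasurableSpace A]

theorem universalCompletion_mono {m₁ m₂ : MeasurableSpace Ω} (h : m₁ ≤ m₂) :
    universalCompletion m₁ ≤ universalCompletion m₂ := by
  intro s hs ν hν
  have h1 : @NullMeasurableSet Ω m₁ s (ν.trim h) := hs (ν.trim h) (isFiniteMeasure_trim h)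
  obtain ⟨t, ht, hst⟩ := h1
  exact ⟨t, h t ht, ae_eq_of_ae_eq_trim hst⟩

theorem le_universalCompletion (m : MeasurableSpace Ω) : m ≤ universalCompletion m :=
  fun _ hs _ _ => MeasurableSet.nullMeasurableSet hs

theorem isDecisionRule_comp {H : Ω → 𝓗} {g : 𝓗 → A} (hg : Measurable g) :
    IsDecisionRule H (g ∘ H) :=
  (hg.comp (comap_measurable H)).mono (le_universalCompletion _) le_rfl

/-- A decision rule agrees almost surely with a measurable function of the information state. -/
theorem IsDecisionRule.exists_measurable_comp [MeasurableSpace Ω] [StandardBorelSpace A]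
    [Nonempty A] {P : Measure Ω} [IsFiniteMeasure P] {H : Ω → 𝓗} (hH : Measurable H) {δ : Ω → A}
    (hδ : IsDecisionRule H δ) : ∃ g : 𝓗 → A, Measurable g ∧ δ =ᵐ[P] g ∘ H := by
  -- Of all finite measures on `σ(H)`, only the trim of `P` is needed.
  have hn : @NullMeasurable Ω A (MeasurableSpace.comap H inferInstance) _ δ
      (P.trim hH.comap_le) := fun s hs => hδ hs _ (isFiniteMeasure_trim hH.comap_le)
  obtain ⟨δ', hδ', hae⟩ := hn.aemeasurable
  obtain ⟨g, hg, rfl⟩ := hδ'.exists_eq_measurable_comp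
  exact ⟨g, hg, ae_eq_of_ae_eq_trim hae⟩

theorem bayesRisk_le [MeasurableSpace Ω] {P : Measure Ω} {Y : Ω → 𝓨} {H : Ω → 𝓗}
    {ℓ : A → 𝓨 → ℝ≥0∞} {g : 𝓗 → A} (hg : Measurable g) :
    bayesRisk P Y H ℓ ≤ ∫⁻ ω, ℓ (g (H ω)) (Y ω) ∂P :=
  iInf₂_le (g ∘ H) (isDecisionRule_comp hg)

theorem le_bayesRisk [MeasurableSpace Ω] [StandardBorelSpace A] {P : Measure Ω}
    [IsProbabilityMeasure P] {Y : Ω → 𝓨} {H : Ω → 𝓗} (hH : Measurable H)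
    {ℓ : A → 𝓨 → ℝ≥0∞} {r : ℝ≥0∞}
    (h : ∀ g : 𝓗 → A, Measurable g → r ≤ ∫⁻ ω, ℓ (g (H ω)) (Y ω) ∂P) :
    r ≤ bayesRisk P Y H ℓ := by
  refine le_iInf₂ fun δ hδ => ?_
  have : Nonempty A := P.nonempty_of_neZero.map δ
  obtain ⟨g, hg, hae⟩ := hδ.exists_measurable_comp (P := P) hH
  refine (h g hg).trans_eq (lintegral_congr_ae ?_)
  filter_upwards [hae] with ω hω
  rw [hω, Function.comp_apply]

theorem bayesRisk_anti {𝓗' : Type*} [MeasurableSpace 𝓗'] [MeasurableSpace Ω] {P : Measure Ω}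
    {Y : Ω → 𝓨} {H : Ω → 𝓗} {p : 𝓗 → 𝓗'} (hp : Measurable p) (ℓ : A → 𝓨 → ℝ≥0∞) :
    bayesRisk P Y H ℓ ≤ bayesRisk P Y (p ∘ H) ℓ := by
  refine le_iInf₂ fun δ hδ => iInf₂_le δ (hδ.mono (universalCompletion_mono ?_) le_rfl)
  exact ((hp.comp (comap_measurable H))).comap_le

end Rules

/-- The loss of the bet in which action `0` costs `t` and action `1` costs `1` if `Y ∈ B`. -/
noncomputable def betLoss {𝓨 : Type*} (B : Set 𝓨) (t : ℝ≥0) (a : Fin 2) (y : 𝓨) : ℝ≥0∞ :=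
  if a = 0 then t else B.indicator 1 y

theorem isBoundedLoss_betLoss {𝓨 : Type*} [MeasurableSpace 𝓨] {B : Set 𝓨} (hB : MeasurableSet B) (t : ℝ≥0) :
    IsBoundedLoss (betLoss B t) where
  measurable := by
    refine Measurable.ite (measurable_fst (measurableSet_singleton 0)) measurable_const ?_
    exact (measurable_one.indicator hB).comp measurable_snd
  bounded := by
    refine ⟨max t 1, fun a y => ?_⟩
    unfold betLoss
    split_ifs
    · exact_mod_cast le_max_left _ _
    · refine (Set.indicator_le_self' (by simp) y).trans ?_
      rw [Pi.one_apply]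
      exact ENNReal.coe_le_coe.2 (le_max_right t 1)

/-! ### Strict gain from a non-redundant signal -/

section Experiments

variable {Ω 𝓨 𝓜 𝓦 : Type*} [MeasurableSpace Ω]
  [MeasurableSpace 𝓨] [StandardBorelSpace 𝓨] [Nonempty 𝓨]
  [MeasurableSpace 𝓜] [MeasurableSpace 𝓦]
  {P : Measure Ω} [IsProbabilityMeasure P] {Y : Ω → 𝓨} {M : Ω → 𝓜} {W : Ω → 𝓦}

theorem lintegral_condDistrib_mul (hY : Measurable Y) (hM : Measurable M) {B : Set 𝓨}
    (hB : MeasurableSet B) {ψ : 𝓜 → ℝ≥0∞} (hψ : Measurable ψ) :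
    ∫⁻ ω, B.indicator 1 (Y ω) * ψ (M ω) ∂P = ∫⁻ ω, condDistrib Y M P (M ω) B * ψ (M ω) ∂P := by
  have hF : Measurable fun p : 𝓜 × 𝓨 => B.indicator (1 : 𝓨 → ℝ≥0∞) p.2 * ψ p.1 :=
    ((measurable_one.indicator hB).comp measurable_snd).mul (hψ.comp measurable_fst)
  calc ∫⁻ ω, B.indicator 1 (Y ω) * ψ (M ω) ∂P
      = ∫⁻ p, B.indicator 1 p.2 * ψ p.1 ∂(P.map fun ω => (M ω, Y ω)) :=
        (lintegral_map hF (hM.prodMk hY)).symm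
    _ = ∫⁻ m, condDistrib Y M P m B * ψ m ∂(P.map M) := by
        rw [← compProd_map_condDistrib hY.aemeasurable, Measure.lintegral_compProd hF]
        refine lintegral_congr fun m => ?_
        dsimp only
        rw [lintegral_mul_const _ (measurable_one.indicator hB), lintegral_indicator_one hB]
    _ = _ := lintegral_map ((Kernel.measurable_coe _ hB).mul hψ) hM

/-- No randomised rule based on `M` beats the pointwise minimum in the bet "pay `t`, or pay `1` if
`Y ∈ B`". -/
theorem lintegral_min_le_randomized (hY : Measurable Y) (hM : Measurable M) {B : Set 𝓨}
    (hB : MeasurableSet B) (t : ℝ≥0∞) {ψ : 𝓜 → ℝ≥0∞} (hψ : Measurable ψ) (hψ1 : ∀ m, ψ m ≤ 1) :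
    ∫⁻ ω, min t (condDistrib Y M P (M ω) B) ∂P ≤
      ∫⁻ ω, t * (1 - ψ (M ω)) + B.indicator 1 (Y ω) * ψ (M ω) ∂P := by
  have h1 : Measurable fun ω => t * (1 - ψ (M ω)) := by fun_prop
  rw [lintegral_add_left h1, lintegral_condDistrib_mul hY hM hB hψ, ← lintegral_add_left h1]
  refine lintegral_mono fun ω => ?_
  calc min t (condDistrib Y M P (M ω) B)
      = min t (condDistrib Y M P (M ω) B) * (1 - ψ (M ω))
          + min t (condDistrib Y M P (M ω) B) * ψ (M ω) := by
        rw [← mul_add, tsub_add_cancel_of_le (hψ1 _), mul_one]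
    _ ≤ _ := by
        gcongr
        · exact min_le_left _ _
        · exact min_le_right _ _

/-- A non-redundant signal strictly improves some bet "pay `t`, or pay `1` if `Y ∈ B`". -/
theorem exists_lintegral_lt_of_not_isRedundant (hY : Measurable Y) (hM : Measurable M)
    (hW : Measurable W) (h : ¬ IsRedundant P Y M W) :
    ∃ (B : Set 𝓨) (t : ℝ≥0) (S : Set (𝓜 × 𝓦)), MeasurableSet B ∧ MeasurableSet S ∧
      ∫⁻ ω, t * (1 - S.indicator 1 (M ω, W ω)) + B.indicator 1 (Y ω) * S.indicator 1 (M ω, W ω) ∂P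
        < ∫⁻ ω, min (t : ℝ≥0∞) (condDistrib Y M P (M ω) B) ∂P := by
  simp only [IsRedundant, not_forall] at h
  obtain ⟨B, hB, hne⟩ := h
  have hMW : Measurable fun ω => (M ω, W ω) := hM.prodMk hW
  set f : Ω → ℝ≥0∞ := fun ω => condDistrib Y (fun ω => (M ω, W ω)) P (M ω, W ω) B with hf
  set g : Ω → ℝ≥0∞ := fun ω => condDistrib Y M P (M ω) B with hg
  have hfm : Measurable f := (Kernel.measurable_coe _ hB).comp hMW
  have hset : ∀ C : Set 𝓜, MeasurableSet C →
      ∫⁻ ω in M ⁻¹' C, f ω ∂P = ∫⁻ ω in M ⁻¹' C, g ω ∂P := by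
    intro C hC
    rw [setLIntegral_preimage_condDistrib hM hY.aemeasurable hB hC]
    have := setLIntegral_preimage_condDistrib (μ := P) hMW hY.aemeasurable hB
      (hC.prod MeasurableSet.univ)
    rw [show (fun ω => (M ω, W ω)) ⁻¹' (C ×ˢ Set.univ) = M ⁻¹' C by ext; simp] at this
    exact this
  have hint : ∫⁻ ω, f ω ∂P = ∫⁻ ω, g ω ∂P := by
    simpa using hset Set.univ MeasurableSet.univ
  have hfin : ∀ C : Set Ω, ∫⁻ ω in C, g ω ∂P ≠ ⊤ := fun C => by
    refine ne_top_of_le_ne_top (measure_ne_top P C) ?_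
    exact (lintegral_mono fun ω => prob_le_one).trans_eq (by simp)
  -- With equal finite integrals, `g ≤ f` would force `f = g` almost surely, against the choice of
  -- `B`.
  have hnle : ¬ g ≤ᵐ[P] f := by
    intro hle
    have heq := ae_eq_of_ae_le_of_lintegral_le hle (by simpa using hfin Set.univ)
      hfm.aemeasurable hint.le
    apply hne
    refine (condDistrib_ae_eq_condExp hMW hY hB).symm.trans
      (Filter.EventuallyEq.trans ?_ (condDistrib_ae_eq_condExp hM hY hB))
    filter_upwards [heq] with ω hω
    exact congrArg ENNReal.toReal hω.symm
  -- Thresholds are rational so that countably many null sets cover `{f < g}`.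
  obtain ⟨t, ht⟩ : ∃ t : ℚ, ¬ ∀ᵐ ω ∂P,
      ¬ (f ω < (Real.toNNReal t : ℝ≥0∞) ∧ (Real.toNNReal t : ℝ≥0∞) < g ω) := by
    by_contra hcon
    apply hnle
    filter_upwards [ae_all_iff.2 fun q => not_not.1 (not_exists.1 hcon q)] with ω hω
    by_contra! hlt
    obtain ⟨q, -, h1, h2⟩ := ENNReal.lt_iff_exists_rat_btwn.1 hlt
    exact hω q ⟨h1, h2⟩
  set τ : ℝ≥0 := Real.toNNReal t
  set C : Set 𝓜 := {m | (τ : ℝ≥0∞) ≤ condDistrib Y M P m B} with hC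
  have hCm : MeasurableSet C := measurableSet_le measurable_const (Kernel.measurable_coe _ hB)
  set S : Set (𝓜 × 𝓦) := {s | condDistrib Y (fun ω => (M ω, W ω)) P s B < τ} with hS
  have hSm : MeasurableSet S := measurableSet_lt (Kernel.measurable_coe _ hB) measurable_const
  refine ⟨B, τ, S, hB, hSm, ?_⟩
  have hSi : Measurable (S.indicator (1 : 𝓜 × 𝓦 → ℝ≥0∞)) := measurable_one.indicator hSm
  have h1 : Measurable fun ω => (τ : ℝ≥0∞) * (1 - S.indicator 1 (M ω, W ω)) :=
    (measurable_const.sub (hSi.comp hMW)).const_mul _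
  -- `S = {f < τ}` is where betting is cheaper than paying `τ`, so this rule attains the pointwise
  -- minimum.
  have hrisk : ∫⁻ ω, τ * (1 - S.indicator 1 (M ω, W ω))
      + B.indicator 1 (Y ω) * S.indicator 1 (M ω, W ω) ∂P = ∫⁻ ω, min (τ : ℝ≥0∞) (f ω) ∂P := by
    rw [lintegral_add_left h1, lintegral_condDistrib_mul hY hMW hB hSi, ← lintegral_add_left h1]
    refine lintegral_congr fun ω => ?_
    by_cases hω : (M ω, W ω) ∈ S
    · have : f ω < τ := hω
      simpa [hω, hf] using this.le
    · have : τ ≤ f ω := not_lt.1 hω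
      simp [hω, min_eq_left this]
  have hminf : Measurable fun ω => min (τ : ℝ≥0∞) (f ω) := measurable_const.min hfm
  have hCM : MeasurableSet (M ⁻¹' C) := hM hCm
  have hτfin : ∀ D : Set Ω, ∫⁻ _ in D, (τ : ℝ≥0∞) ∂P ≠ ⊤ := fun D => by
    simpa using ENNReal.mul_ne_top ENNReal.coe_ne_top (measure_ne_top P D)
  have hminfin : ∀ D : Set Ω, ∫⁻ ω in D, min (τ : ℝ≥0∞) (f ω) ∂P ≠ ⊤ := fun D =>
    ne_top_of_le_ne_top (hτfin D) (lintegral_mono fun _ => min_le_left _ _)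
  rw [hrisk, ← lintegral_add_compl (fun ω => min (τ : ℝ≥0∞) (f ω)) hCM,
    ← lintegral_add_compl (fun ω => min (τ : ℝ≥0∞) (condDistrib Y M P (M ω) B)) hCM]
  -- On `{g ≥ τ}` the right integrand is the constant `τ`, and `f < τ` on a non-null part. Off it
  -- the minimum is `g`, whose integral equals that of `f`.
  refine ENNReal.add_lt_add_of_lt_of_le (hminfin _) ?_ ?_
  · have hgC : ∫⁻ ω in M ⁻¹' C, min (τ : ℝ≥0∞) (g ω) ∂P = ∫⁻ _ in M ⁻¹' C, (τ : ℝ≥0∞) ∂P :=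
      setLIntegral_congr_fun hCM fun ω hω => min_eq_left hω
    refine lt_of_lt_of_eq ?_ hgC.symm
    by_contra! hcon
    have heq := ae_eq_of_ae_le_of_lintegral_le (μ := P.restrict (M ⁻¹' C))
      (f := fun ω => min (τ : ℝ≥0∞) (f ω)) (g := fun _ => (τ : ℝ≥0∞))
      (Filter.Eventually.of_forall fun _ => min_le_left _ _) (hminfin _)
      aemeasurable_const hcon
    apply ht
    filter_upwards [(ae_restrict_iff' hCM).1 heq] with ω hω hcon
    exact (min_eq_left_iff.1 (hω hcon.2.le)).not_gt hcon.1
  · calc ∫⁻ ω in (M ⁻¹' C)ᶜ, min (τ : ℝ≥0∞) (f ω) ∂P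
        ≤ ∫⁻ ω in (M ⁻¹' C)ᶜ, f ω ∂P := lintegral_mono fun _ => min_le_right _ _
      _ = ∫⁻ ω in (M ⁻¹' C)ᶜ, g ω ∂P := hset Cᶜ hCm.compl
      _ = ∫⁻ ω in (M ⁻¹' C)ᶜ, min (τ : ℝ≥0∞) (g ω) ∂P :=
        setLIntegral_congr_fun hCM.compl fun ω hω =>
          (min_eq_right (le_of_not_ge fun hle => hω hle)).symm

theorem exists_bayesRisk_lt_of_not_isRedundant (hY : Measurable Y) (hM : Measurable M)
    (hW : Measurable W) (h : ¬ IsRedundant P Y M W) :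
    ∃ (n : ℕ) (ℓ : Fin n → 𝓨 → ℝ≥0∞), IsBoundedLoss ℓ ∧
      bayesRisk P Y (fun ω => (M ω, W ω)) ℓ < bayesRisk P Y M ℓ := by
  classical
  obtain ⟨B, t, S, hB, hS, hlt⟩ := exists_lintegral_lt_of_not_isRedundant hY hM hW h
  refine ⟨2, betLoss B t, isBoundedLoss_betLoss hB t, ?_⟩
  refine lt_of_le_of_lt ?_ (hlt.trans_le ?_)
  · refine (bayesRisk_le (g := fun s => if s ∈ S then (1 : Fin 2) else 0)
      (Measurable.ite hS measurable_const measurable_const)).trans_eq (lintegral_congr fun ω => ?_)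
    by_cases hω : (M ω, W ω) ∈ S <;> simp [betLoss, hω]
  · refine le_bayesRisk hM fun g hg => ?_
    have hD : MeasurableSet (g ⁻¹' {1}) := hg (measurableSet_singleton 1)
    refine (lintegral_min_le_randomized (P := P) hY hM hB t
      (ψ := (g ⁻¹' {1}).indicator 1) (measurable_one.indicator hD)
      fun m => Set.indicator_le_self' (by simp) m).trans_eq (lintegral_congr fun ω => ?_)
    by_cases hω : g (M ω) = 1
    · simp [betLoss, hω]
    · have : g (M ω) = 0 := by omega
      simp [betLoss, this]

end Experiments

/-! ### Blackwell domination, redundancy and ancillary noise -/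

section Domination

variable {Ω 𝓨 𝓜 𝓦 : Type*} [MeasurableSpace Ω]
  [MeasurableSpace 𝓨] [MeasurableSpace 𝓜] [MeasurableSpace 𝓦]
  {P : Measure Ω} [IsProbabilityMeasure P] {Y : Ω → 𝓨} {M : Ω → 𝓜} {W : Ω → 𝓦}

/-- Only the law of the pair `(Y, S)` is reproduced by a draw from `κ (M ω)`; nothing is claimed
jointly with `M`. -/
theorem lintegral_eq_of_condDistrib_eq_comp [StandardBorelSpace 𝓜] [Nonempty 𝓜]
    {𝓢 : Type*} [MeasurableSpace 𝓢]
    [StandardBorelSpace 𝓢] [Nonempty 𝓢] {S : Ω → 𝓢} (hY : Measurable Y) (hM : Measurable M)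
    (hS : Measurable S) {κ : Kernel 𝓜 𝓢} [IsMarkovKernel κ]
    (h : ∀ᵐ y ∂(P.map Y), condDistrib S Y P y = (κ ∘ₖ condDistrib M Y P) y)
    {F : 𝓨 × 𝓢 → ℝ≥0∞} (hF : Measurable F) :
    ∫⁻ ω, F (Y ω, S ω) ∂P = ∫⁻ ω, ∫⁻ s, F (Y ω, s) ∂(κ (M ω)) ∂P := by
  have hG : Measurable fun p : 𝓨 × 𝓜 => ∫⁻ s, F (p.1, s) ∂(κ p.2) :=
    Measurable.lintegral_kernel_prod_right' (κ := κ.prodMkLeft 𝓨)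
      (f := fun q : (𝓨 × 𝓜) × 𝓢 => F (q.1.1, q.2)) (by fun_prop)
  calc ∫⁻ ω, F (Y ω, S ω) ∂P = ∫⁻ p, F p ∂(P.map fun ω => (Y ω, S ω)) :=
        (lintegral_map hF (hY.prodMk hS)).symm
    _ = ∫⁻ y, ∫⁻ s, F (y, s) ∂(condDistrib S Y P y) ∂(P.map Y) := by
        rw [← compProd_map_condDistrib hS.aemeasurable, Measure.lintegral_compProd hF]
    _ = ∫⁻ y, ∫⁻ m, ∫⁻ s, F (y, s) ∂(κ m) ∂(condDistrib M Y P y) ∂(P.map Y) := by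
        refine lintegral_congr_ae ?_
        filter_upwards [h] with y hy
        rw [hy, Kernel.lintegral_comp _ _ _ (by fun_prop)]
    _ = ∫⁻ p, ∫⁻ s, F (p.1, s) ∂(κ p.2) ∂(P.map fun ω => (Y ω, M ω)) := by
        rw [← compProd_map_condDistrib hM.aemeasurable, Measure.lintegral_compProd hG]
    _ = _ := lintegral_map hG (hY.prodMk hM)

/-- The kernel turns the improving bet on `S` into the rule that bets with probability `κ m S`,
contradicting the bound for randomised rules. -/
theorem isRedundant_of_blackwellDominated [StandardBorelSpace 𝓨] [Nonempty 𝓨] [StandardBorelSpace 𝓜] [Nonempty 𝓜]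
    [StandardBorelSpace 𝓦] [Nonempty 𝓦]
    (hY : Measurable Y) (hM : Measurable M)
    (hW : Measurable W) (h : BlackwellDominated P Y (fun ω => (M ω, W ω)) M) :
    IsRedundant P Y M W := by
  by_contra hred
  obtain ⟨B, t, S, hB, hS, hlt⟩ := exists_lintegral_lt_of_not_isRedundant hY hM hW hred
  obtain ⟨κ, hκ, hdom⟩ := h
  refine hlt.not_ge ?_
  have hSi : Measurable (S.indicator (1 : 𝓜 × 𝓦 → ℝ≥0∞)) := measurable_one.indicator hS
  have hBi : Measurable (B.indicator (1 : 𝓨 → ℝ≥0∞)) := measurable_one.indicator hB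
  rw [lintegral_eq_of_condDistrib_eq_comp hY hM (hM.prodMk hW) hdom
    (F := fun p => t * (1 - S.indicator 1 p.2) + B.indicator 1 p.1 * S.indicator 1 p.2)
    (by fun_prop)]
  refine (lintegral_min_le_randomized (P := P) hY hM hB t (Kernel.measurable_coe κ hS)
    fun m => prob_le_one).trans_eq (lintegral_congr fun ω => ?_)
  have hc : ∀ s, (1 : ℝ≥0∞) - S.indicator 1 s = Sᶜ.indicator 1 s := fun s => by
    by_cases hs : s ∈ S <;> simp [hs]
  simp_rw [hc]
  rw [lintegral_add_left ((measurable_one.indicator hS.compl).const_mul _),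
    lintegral_const_mul _ (measurable_one.indicator hS.compl), lintegral_const_mul _ hSi,
    lintegral_indicator_one hS.compl, lintegral_indicator_one hS, prob_compl_eq_one_sub hS]

/-- Integration against the joint law of `(M, Y, ξ)` when `ξ` and `Y` are conditionally independent
given `M`. -/
theorem lintegral_eq_of_condIndepFun [StandardBorelSpace 𝓨] [Nonempty 𝓨]
    {Ξ : Type*} [StandardBorelSpace Ω] [MeasurableSpace Ξ]
    [StandardBorelSpace Ξ] [Nonempty Ξ] {ξ : Ω → Ξ} (hY : Measurable Y) (hM : Measurable M)
    (hξ : Measurable ξ)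
    (h : CondIndepFun (MeasurableSpace.comap M inferInstance) hM.comap_le ξ Y P)
    {F : (𝓜 × 𝓨) × Ξ → ℝ≥0∞} (hF : Measurable F) :
    ∫⁻ ω, F ((M ω, Y ω), ξ ω) ∂P = ∫⁻ ω, ∫⁻ x, F ((M ω, Y ω), x) ∂(condDistrib ξ M P (M ω)) ∂P := by
  have hMY : Measurable fun ω => (M ω, Y ω) := hM.prodMk hY
  have heq := (condIndepFun_iff_condDistrib_prod_ae_eq_prodMkRight hξ hY hM).1 h.symm
  rw [condDistrib_ae_eq_iff_measure_eq_compProd _ hξ.aemeasurable] at heq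
  rw [← lintegral_map hF (hMY.prodMk hξ), heq, Measure.lintegral_compProd hF,
    lintegral_map hF.lintegral_kernel_prod_right' hMY]
  rfl

/-- The garbling keeps `m` and draws the signal from its law given `m`; conditional independence
makes `y` irrelevant to that draw. -/
theorem blackwellDominated_of_condIndepFun [StandardBorelSpace 𝓨] [Nonempty 𝓨]
    [StandardBorelSpace 𝓜] [Nonempty 𝓜] [StandardBorelSpace 𝓦] [Nonempty 𝓦]
    [StandardBorelSpace Ω] (hY : Measurable Y)
    (hM : Measurable M) (hW : Measurable W)
    (h : CondIndepFun (MeasurableSpace.comap M inferInstance) hM.comap_le W Y P) :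
    BlackwellDominated P Y (fun ω => (M ω, W ω)) M := by
  refine ⟨Kernel.id ×ₖ condDistrib W M P, inferInstance, ?_⟩
  refine condDistrib_ae_eq_of_measure_eq_compProd Y (hM.prodMk hW).aemeasurable ?_
  refine Measure.ext_of_lintegral _ fun F hF => ?_
  have hG : Measurable fun p : 𝓨 × 𝓜 => ∫⁻ w, F (p.1, (p.2, w)) ∂(condDistrib W M P p.2) :=
    Measurable.lintegral_kernel_prod_right' (κ := (condDistrib W M P).prodMkLeft 𝓨)
      (f := fun q : (𝓨 × 𝓜) × 𝓦 => F (q.1.1, (q.1.2, q.2))) (by fun_prop)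
  rw [lintegral_map hF (hY.prodMk (hM.prodMk hW)),
    lintegral_eq_of_condIndepFun hY hM hW h (F := fun q => F (q.1.2, (q.1.1, q.2))) (by fun_prop),
    ← lintegral_map hG (hY.prodMk hM), ← compProd_map_condDistrib hM.aemeasurable,
    Measure.lintegral_compProd hG, Measure.lintegral_compProd hF]
  refine lintegral_congr fun y => ?_
  rw [Kernel.lintegral_comp _ _ _ (by fun_prop)]
  refine lintegral_congr fun m => ?_
  rw [Kernel.lintegral_id_prod (by fun_prop)]

theorem condIndepFun_of_isRedundant [StandardBorelSpace 𝓨] [Nonempty 𝓨] [StandardBorelSpace 𝓦] [Nonempty 𝓦]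
    [StandardBorelSpace Ω] (hY : Measurable Y)
    (hM : Measurable M) (hW : Measurable W) (h : IsRedundant P Y M W) :
    CondIndepFun (MeasurableSpace.comap M inferInstance) hM.comap_le W Y P := by
  have hMW : Measurable fun ω => (M ω, W ω) := hM.prodMk hW
  refine (condIndepFun_iff_condDistrib_prod_ae_eq_prodMkRight hY hW hM).2 ?_
  refine condDistrib_ae_eq_of_measure_eq_compProd _ hY.aemeasurable ?_
  -- The null set in `h` depends on `B`, so the laws are compared on rectangles, one `B` at a time.
  refine Measure.ext_prod fun {D B} hD hB => ?_
  rw [Measure.map_apply (hMW.prodMk hY) (hD.prod hB), Measure.compProd_apply_prod hD hB,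
    setLIntegral_map hD (Kernel.measurable_coe _ hB) hMW, Set.mk_preimage_prod,
    ← setLIntegral_preimage_condDistrib hMW hY.aemeasurable hB hD]
  refine lintegral_congr_ae (ae_restrict_of_ae ?_)
  filter_upwards [condDistrib_ae_eq_condExp (μ := P) hMW hY hB,
    condDistrib_ae_eq_condExp (μ := P) hM hY hB, h B hB] with ω h1 h2 h3
  exact (ENNReal.toReal_eq_toReal_iff' (measure_ne_top _ _) (measure_ne_top _ _)).1
    (h1.trans (h3.trans h2.symm))

theorem blackwellDominated_iff_isRedundant [StandardBorelSpace 𝓨] [Nonempty 𝓨]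
    [StandardBorelSpace 𝓜] [Nonempty 𝓜] [StandardBorelSpace 𝓦] [Nonempty 𝓦]
    [StandardBorelSpace Ω] (hY : Measurable Y)
    (hM : Measurable M) (hW : Measurable W) :
    BlackwellDominated P Y (fun ω => (M ω, W ω)) M ↔ IsRedundant P Y M W :=
  ⟨isRedundant_of_blackwellDominated hY hM hW, fun h =>
    blackwellDominated_of_condIndepFun hY hM hW (condIndepFun_of_isRedundant hY hM hW h)⟩

/-- A rule that also uses ancillary randomness is matched by one that does not. -/
theorem exists_lintegral_le_of_condIndepFun [StandardBorelSpace 𝓨] [Nonempty 𝓨]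
    {Ξ A : Type*} [StandardBorelSpace Ω]
    [MeasurableSpace Ξ] [StandardBorelSpace Ξ] [Nonempty Ξ] [MeasurableSpace A] {ξ : Ω → Ξ}
    (hY : Measurable Y) (hM : Measurable M) (hξ : Measurable ξ)
    (h : CondIndepFun (MeasurableSpace.comap M inferInstance) hM.comap_le ξ Y P)
    {ℓ : A → 𝓨 → ℝ≥0∞} (hℓ : Measurable (Function.uncurry ℓ)) {g : 𝓜 × Ξ → A}
    (hg : Measurable g) :
    ∃ g' : 𝓜 → A, Measurable g' ∧
      ∫⁻ ω, ℓ (g' (M ω)) (Y ω) ∂P ≤ ∫⁻ ω, ℓ (g (M ω, ξ ω)) (Y ω) ∂P := by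
  -- `f m` pushes the uniform law on the unit interval to the law of `ξ` given `M = m`.
  obtain ⟨f, hf, hfmap⟩ := (condDistrib ξ M P).exists_measurable_map_eq_unitInterval
  have hF : Measurable fun q : (𝓜 × 𝓨) × Ξ => ℓ (g (q.1.1, q.2)) q.1.2 :=
    hℓ.comp (Measurable.prodMk (by fun_prop) (by fun_prop))
  have hJ : Measurable fun p : Ω × unitInterval => ℓ (g (M p.1, f (M p.1) p.2)) (Y p.1) :=
    hF.comp (((hM.comp measurable_fst).prodMk (hY.comp measurable_fst)).prodMk
      (hf.comp ((hM.comp measurable_fst).prodMk measurable_snd)))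
  have key : ∫⁻ ω, ℓ (g (M ω, ξ ω)) (Y ω) ∂P =
      ∫⁻ u : unitInterval, ∫⁻ ω, ℓ (g (M ω, f (M ω) u)) (Y ω) ∂P := by
    rw [lintegral_eq_of_condIndepFun hY hM hξ h hF,
      ← lintegral_lintegral_swap (f := fun ω u => ℓ (g (M ω, f (M ω) u)) (Y ω)) hJ.aemeasurable]
    refine lintegral_congr fun ω => ?_
    rw [← hfmap (M ω)]
    exact lintegral_map (hF.comp measurable_prodMk_left) (hf.comp measurable_prodMk_left)
  -- One seed `u`, the same for all `m`, has risk at most the average.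
  obtain ⟨u, hu⟩ := exists_le_lintegral (μ := (volume : Measure unitInterval))
    (f := fun u => ∫⁻ ω, ℓ (g (M ω, f (M ω) u)) (Y ω) ∂P)
    (hJ.lintegral_prod_left').aemeasurable
  exact ⟨fun m => g (m, f m u),
    hg.comp (measurable_id.prodMk (hf.comp measurable_prodMk_right)), key ▸ hu⟩

theorem bayesRisk_eq_of_ancillary [StandardBorelSpace 𝓨] [Nonempty 𝓨]
    {Ξ A : Type*} [StandardBorelSpace Ω]
    [MeasurableSpace Ξ] [StandardBorelSpace Ξ] [MeasurableSpace A] [StandardBorelSpace A]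
    {ξ : Ω → Ξ} {c : 𝓜 × Ξ → 𝓦} (hY : Measurable Y) (hM : Measurable M) (hW : Measurable W)
    (hξ : Measurable ξ) (hc : Measurable c)
    (h : CondIndepFun (MeasurableSpace.comap M inferInstance) hM.comap_le ξ Y P)
    (hWc : ∀ᵐ ω ∂P, W ω = c (M ω, ξ ω)) {ℓ : A → 𝓨 → ℝ≥0∞} (hℓ : IsBoundedLoss ℓ) :
    bayesRisk P Y (fun ω => (M ω, W ω)) ℓ = bayesRisk P Y M ℓ := by
  refine le_antisymm (bayesRisk_anti measurable_fst ℓ) (le_bayesRisk (hM.prodMk hW) fun g hg => ?_)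
  have : Nonempty Ξ := P.nonempty_of_neZero.map ξ
  obtain ⟨g', hg', hle⟩ := exists_lintegral_le_of_condIndepFun hY hM hξ h hℓ.measurable
    (g := fun p => g (p.1, c p)) (hg.comp (measurable_fst.prodMk hc))
  refine (bayesRisk_le hg').trans (hle.trans_eq (lintegral_congr_ae ?_))
  filter_upwards [hWc] with ω hω
  rw [hω]

end Domination

/-- A fair bit `Y`, a constant state `M`, and a signal `W` revealing `Y`. -/
noncomputable def revealingLaw : Measure (Bool × Bool × Bool) :=
  (2⁻¹ : ℝ≥0∞) • Measure.dirac (false, false, false)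
    + (2⁻¹ : ℝ≥0∞) • Measure.dirac (true, false, true)

instance : IsProbabilityMeasure revealingLaw :=
  ⟨by simp [revealingLaw, ENNReal.inv_two_add_inv_two]⟩

theorem lintegral_revealingLaw (f : Bool × Bool × Bool → ℝ≥0∞) :
    ∫⁻ ω, f ω ∂revealingLaw = 2⁻¹ * f (false, false, false) + 2⁻¹ * f (true, false, true) := by
  simp [revealingLaw, lintegral_add_measure, lintegral_smul_measure]

theorem exists_bayesRisk_lt_bool :
    ∃ Q : Measure (Bool × Bool × Bool), IsProbabilityMeasure Q ∧
      ∃ ℓ : Bool → Bool → ℝ≥0∞, IsBoundedLoss ℓ ∧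
        bayesRisk Q (fun ω => ω.1) (fun ω => (ω.2.1, ω.2.2)) ℓ <
          bayesRisk Q (fun ω => ω.1) (fun ω => ω.2.1) ℓ := by
  refine ⟨revealingLaw, inferInstance, fun a y => if a = y then 0 else 1, ⟨?_, 1, ?_⟩, ?_⟩
  · exact measurable_of_countable _
  · intro a y
    split_ifs <;> simp
  -- Copying the signal costs `0`; with `M` constant, any guess errs with probability `1/2`.
  refine lt_of_le_of_lt (b := 0) ?_ (lt_of_lt_of_le (b := 2⁻¹) (by simp) ?_)
  · refine (bayesRisk_le (g := Prod.snd) measurable_snd).trans ?_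
    simp [lintegral_revealingLaw]
  · refine le_bayesRisk (by fun_prop) fun g hg => ?_
    rw [lintegral_revealingLaw]
    cases g false <;> simp

end DecisionModel

theorem corollary1 {Ω 𝓨 𝓜 𝓦 : Type*}
    [MeasurableSpace Ω] [StandardBorelSpace Ω]
    [MeasurableSpace 𝓨] [StandardBorelSpace 𝓨]
    [MeasurableSpace 𝓜] [StandardBorelSpace 𝓜] [Nonempty 𝓜]
    [MeasurableSpace 𝓦] [StandardBorelSpace 𝓦] [Nonempty 𝓦]
    (P : Measure Ω) [IsProbabilityMeasure P]
    (Y : Ω → 𝓨) (M : Ω → 𝓜) (W : Ω → 𝓦)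
    (hY : Measurable Y) (hM : Measurable M) (hW : Measurable W) :
    -- adding a verifier signal never hurts
    (∀ (A : Type*) [MeasurableSpace A] [StandardBorelSpace A] (ℓ : A → 𝓨 → ℝ≥0∞),
      DecisionModel.IsBoundedLoss ℓ →
        DecisionModel.bayesRisk P Y (fun ω => (M ω, W ω)) ℓ ≤ DecisionModel.bayesRisk P Y M ℓ) ∧
    -- it helps strictly, for some finite-action bounded loss, when not Blackwell-dominated
    (¬ DecisionModel.BlackwellDominated P Y (fun ω => (M ω, W ω)) M →
      ∃ (n : ℕ) (ℓ : Fin n → 𝓨 → ℝ≥0∞), DecisionModel.IsBoundedLoss ℓ ∧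
        DecisionModel.bayesRisk P Y (fun ω => (M ω, W ω)) ℓ < DecisionModel.bayesRisk P Y M ℓ) ∧
    -- not being Blackwell-dominated means not being redundant for predicting `Y`
    (¬ DecisionModel.BlackwellDominated P Y (fun ω => (M ω, W ω)) M ↔
      ¬ DecisionModel.IsRedundant P Y M W) ∧
    -- self-critique: a signal made from `M` and ancillary randomness leaves the value unchanged
    (∀ (Ξ : Type*) [MeasurableSpace Ξ] [StandardBorelSpace Ξ] (ξ : Ω → Ξ) (c : 𝓜 × Ξ → 𝓦),
      Measurable ξ → Measurable c →
      CondIndepFun (MeasurableSpace.comap M inferInstance) hM.comap_le ξ Y P →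
      (∀ᵐ ω ∂P, W ω = c (M ω, ξ ω)) →
      ∀ (A : Type*) [MeasurableSpace A] [StandardBorelSpace A] (ℓ : A → 𝓨 → ℝ≥0∞),
        DecisionModel.IsBoundedLoss ℓ →
          DecisionModel.bayesRisk P Y (fun ω => (M ω, W ω)) ℓ =
            DecisionModel.bayesRisk P Y M ℓ) ∧
    -- an external signal can lower the value: a law of `(Y, M, W)` on three bits where it does
    (∃ Q : Measure (Bool × Bool × Bool), IsProbabilityMeasure Q ∧
      ∃ ℓ : Bool → Bool → ℝ≥0∞, DecisionModel.IsBoundedLoss ℓ ∧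
        DecisionModel.bayesRisk Q (fun ω => ω.1) (fun ω => (ω.2.1, ω.2.2)) ℓ <
          DecisionModel.bayesRisk Q (fun ω => ω.1) (fun ω => ω.2.1) ℓ) := by
  have : Nonempty 𝓨 := P.nonempty_of_neZero.map Y
  have hiff := DecisionModel.blackwellDominated_iff_isRedundant (P := P) hY hM hW
  refine ⟨fun A _ _ ℓ _ => DecisionModel.bayesRisk_anti measurable_fst ℓ, fun h => ?_,
    not_congr hiff, ?_, DecisionModel.exists_bayesRisk_lt_bool⟩
  · exact DecisionModel.exists_bayesRisk_lt_of_not_isRedundant hY hM hW (hiff.not.1 h)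
  · intro Ξ _ _ ξ c hξ hc hind hWc A _ _ ℓ hℓ
    exact DecisionModel.bayesRisk_eq_of_ancillary hY hM hW hξ hc hind hWc hℓ
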